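/- Let the Fibonacci numbers be $F_0 = 0$, $F_1 = 1$, $F_n = F_{n-1} + F_{n-2}$ for $n \ge 2$, and let the finite Fibonacci words over the alphabet $\{0,1\}$ be $X_0 = \varepsilon$ (the empty word), $X_1 = 1$, $X_2 = 0$, and $X_n = X_{n-1}X_{n-2}$ for $n > 2$. A square is a nonempty word of the form $xx$; its order is $|x|$. Let $B(n)$ denote the total number of occurrences of squares in $X_n$, i.e., the number of pairs $(i,j)$ with $i \ge 0$, $j \ge 1$, $i + 2j \le |X_n|$ such that the factor of $X_n$ of length $2j$ beginning at position $i$ (positions counted from $0$) is a square. Then, for all $n \ge 3$, $$B(n+1) = \frac{4}{5}\, n F_{n+1} - \frac{2}{5}(n+6) F_n - 4F_{n-1} + n + 1 .$$ -/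

import Mathlib

/-- The finite Fibonacci words over the alphabet `{0, 1}`:
`X 0 = ε`, `X 1 = 1`, `X 2 = 0`, and `X n = X (n - 1) X (n - 2)` for `n > 2`. -/
def fibWord : ℕ → List (Fin 2)
  | 0 => []
  | 1 => [1]
  | 2 => [0]
  | n + 3 => fibWord (n + 2) ++ fibWord (n + 1)

/-- A square is a nonempty word of the form `x x`. -/
def IsSquareWord {α : Type*} (s : List α) : Prop :=
  ∃ x : List α, x ≠ [] ∧ s = x ++ x

open Classical in
/-- The occurrences of squares in a finite word `w`: the pairs `(i, j)` such that `w` has a factor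
of length `2 * j` beginning at position `i` (positions are counted from `0`), and this factor
is a square (necessarily of order `j ≥ 1`). -/
noncomputable def squareOccurrences {α : Type*} (w : List α) : Finset (ℕ × ℕ) :=
  (Finset.range (w.length + 1) ×ˢ Finset.range (w.length + 1)).filter fun p =>
    p.1 + 2 * p.2 ≤ w.length ∧ IsSquareWord ((w.drop p.1).take (2 * p.2))

/-- `B n` is the total number of occurrences of squares in the finite Fibonacci word `X n`. -/
noncomputable def numSquareOccurrences (n : ℕ) : ℕ :=
  (squareOccurrences (fibWord n)).card

/-! All `X n` with `n ≥ 2` are prefixes of one infinite word, so the task is to locate the squares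
of that word. The word is self-similar: for each `k`, replacing 0 by `X_{k+3}` and 1 by `X_{k+2}`
reproduces it.

Two facts carry the count. The order of a square is always some `F_{k+2}`
(`FibSquareAt.exists_order_eq_fib`): a square of order at least 2 starting and followed by 0 is the
image under 0 → 01, 1 → 0 of a shorter one, and every other square rotates to this kind or has order
1 or 3. For order `F_{k+2}`, every position in a block of a 1 starts a square, while in a block of a
0 exactly the first `F_{k+1} - 1` do, because `X_{k+2} X_{k+3}` and `X_{k+3} X_{k+2}` disagree just
in their last two letters.

Counting block by block up to the last admissible start gives a closed form for each order
(`count_fibSquareAt_fib`). Summing over the orders leaves a Fibonacci convolution, evaluated in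
`five_mul_sum_fib_mul_fib`. -/

/-! ### The infinite Fibonacci word and its prefixes. -/

/-- The infinite Fibonacci word. -/
def fibLetter (i : ℕ) : Fin 2 := (fibWord (i + 2)).getD i 0

lemma length_fibWord : ∀ n, (fibWord n).length = Nat.fib n
  | 0 => rfl
  | 1 => rfl
  | 2 => rfl
  | n + 3 => by
    rw [fibWord, List.length_append, length_fibWord (n + 2), length_fibWord (n + 1),
      Nat.fib_add_two (n := n + 1), add_comm]

lemma fibWord_prefix (n d : ℕ) : fibWord (n + 2) <+: fibWord (n + 2 + d) := by
  induction d with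
  | zero => exact List.prefix_rfl
  | succ d ih => exact ih.trans ⟨fibWord (n + d + 1), by
      rw [show n + 2 + (d + 1) = n + d + 3 by ring, fibWord, show n + 2 + d = n + d + 2 by ring]⟩

lemma lt_fib_add_two (i : ℕ) : i < Nat.fib (i + 2) := by
  induction i with
  | zero => simp
  | succ i ih =>
    have h : Nat.fib (i + 3) = Nat.fib (i + 1) + Nat.fib (i + 2) := Nat.fib_add_two
    have : 0 < Nat.fib (i + 1) := Nat.fib_pos.2 (by omega)
    change _ < Nat.fib (i + 3)
    omega

/-- Since `i < F_{i+2}`, the default value in `fibLetter` is never used. -/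
lemma fibWord_getElem? (n i : ℕ) (h : i < Nat.fib (n + 2)) :
    (fibWord (n + 2))[i]? = some (fibLetter i) := by
  have hi : i < (fibWord (i + 2)).length := by rw [length_fibWord]; exact lt_fib_add_two i
  have key : (fibWord (i + 2))[i]? = some (fibLetter i) := by
    simp [fibLetter, List.getElem?_eq_getElem hi]
  rcases le_total i n with hn | hn
  · obtain ⟨d, rfl⟩ := Nat.exists_eq_add_of_le hn
    rw [show i + d + 2 = i + 2 + d by ring]
    exact (List.prefix_iff_getElem?.1 (fibWord_prefix i d) i hi) ▸
      (List.getElem?_eq_getElem hi ▸ key)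
  · obtain ⟨d, hd⟩ := Nat.exists_eq_add_of_le hn
    have hi' : i < (fibWord (n + 2)).length := by rwa [length_fibWord]
    rw [show i + 2 = n + 2 + d by omega,
      List.prefix_iff_getElem?.1 (fibWord_prefix n d) i hi'] at key
    rw [List.getElem?_eq_getElem hi', key]

lemma fibLetter_fib_add (k o : ℕ) (h : o < Nat.fib (k + 2)) :
    fibLetter (Nat.fib (k + 3) + o) = fibLetter o := by
  have h1 := fibWord_getElem? (k + 2) (Nat.fib (k + 3) + o) (by
    rw [Nat.fib_add_two (n := k + 2)]; change _ < _ + Nat.fib (k + 3); omega)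
  rw [fibWord, List.getElem?_append_right (by rw [length_fibWord]; exact Nat.le_add_right _ _),
    length_fibWord, Nat.add_sub_cancel_left, fibWord_getElem? k o h] at h1
  exact (Option.some.inj h1).symm

/-! ### Self-similarity: factorization into blocks. -/

/-- Start of the `m`-th block in the factorization of the infinite Fibonacci word into the
words `fibWord (k + 3)` (for the letter `0`) and `fibWord (k + 2)` (for the letter `1`). -/
def blockStart (k m : ℕ) : ℕ :=
  ∑ l ∈ Finset.range m, if fibLetter l = 0 then Nat.fib (k + 3) else Nat.fib (k + 2)

lemma blockStart_zero (k : ℕ) : blockStart k 0 = 0 := rfl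

lemma blockStart_succ (k m : ℕ) : blockStart k (m + 1) =
    blockStart k m + if fibLetter m = 0 then Nat.fib (k + 3) else Nat.fib (k + 2) :=
  Finset.sum_range_succ _ _

lemma blockStart_fib_add (k r m : ℕ) (h : m ≤ Nat.fib (r + 2)) :
    blockStart k (Nat.fib (r + 3) + m) = blockStart k (Nat.fib (r + 3)) + blockStart k m := by
  rw [blockStart, Finset.sum_range_add]
  congr 1
  refine Finset.sum_congr rfl fun x hx => ?_
  rw [fibLetter_fib_add r x ((Finset.mem_range.1 hx).trans_le h)]

lemma fibLetter_zero : fibLetter 0 = 0 := by decide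
lemma fibLetter_one : fibLetter 1 = 1 := by decide

lemma blockStart_fib (k : ℕ) : ∀ r, blockStart k (Nat.fib (r + 2)) = Nat.fib (r + k + 3)
  | 0 => by simp [blockStart, fibLetter_zero]
  | 1 => by
    have : Nat.fib (1 + 2) = 2 := rfl
    rw [this, blockStart_succ, blockStart_succ, blockStart_zero, fibLetter_zero, fibLetter_one,
      show 1 + k + 3 = k + 2 + 2 by ring, Nat.fib_add_two (n := k + 2)]
    simp [add_comm, add_left_comm]
  | r + 2 => by
    rw [Nat.fib_add_two (n := r + 2), add_comm, blockStart_fib_add k r _ le_rfl,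
      blockStart_fib k (r + 1), blockStart_fib k r, show r + 2 + k + 3 = r + k + 3 + 2 by ring,
      Nat.fib_add_two (n := r + k + 3), add_comm, show r + 1 + k + 3 = r + k + 3 + 1 by ring]

lemma blockStart_mono (k : ℕ) : Monotone (blockStart k) :=
  monotone_nat_of_le_succ fun m => by rw [blockStart_succ]; exact Nat.le_add_right _ _

/-- Induction on `r`: the first `F_{r+3}` blocks have total length `F_{r+k+4}`, and beyond them both
the sequence of blocks and the letters repeat from the beginning. -/
lemma fibLetter_blockStart_add (k : ℕ) : ∀ r m o, m < Nat.fib (r + 2) →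
    blockStart k m + o < blockStart k (m + 1) →
    fibLetter (blockStart k m + o) = fibLetter o
  | 0, m, o, hm, ho => by
    obtain rfl : m = 0 := by simpa using hm
    simp [blockStart_zero]
  | 1, m, o, hm, ho => by
    have : Nat.fib (1 + 2) = 2 := rfl
    rw [blockStart_succ] at ho
    obtain rfl | rfl : m = 0 ∨ m = 1 := by omega
    · simp [blockStart_zero]
    · rw [fibLetter_one] at ho
      rw [blockStart_succ, fibLetter_zero, blockStart_zero]
      simp at ho ⊢
      exact fibLetter_fib_add k o ho
  | r + 2, m, o, hm, ho => by
    have h4 : Nat.fib (r + 2 + 2) = Nat.fib (r + 2) + Nat.fib (r + 3) := Nat.fib_add_two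
    rcases lt_or_ge m (Nat.fib (r + 3)) with h | h
    · exact fibLetter_blockStart_add k (r + 1) m o h ho
    · obtain ⟨m', rfl⟩ := Nat.exists_eq_add_of_le h
      have hm' : m' < Nat.fib (r + 2) := by omega
      rw [add_assoc, blockStart_fib_add k r _ hm'.le, blockStart_fib_add k r (m' + 1) hm', add_assoc] at ho
      rw [blockStart_fib_add k r _ hm'.le, add_assoc, blockStart_fib k (r + 1),
        show r + 1 + k + 3 = r + k + 1 + 3 by ring]
      have h1 : blockStart k m' + o < blockStart k (m' + 1) := by omega
      rw [fibLetter_fib_add _ _ ?_]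
      · exact fibLetter_blockStart_add k r m' o hm' h1
      · have : blockStart k (m' + 1) ≤ blockStart k (Nat.fib (r + 2)) := blockStart_mono k hm'
        rw [blockStart_fib, show r + k + 3 = r + k + 1 + 2 by ring] at this
        omega

lemma fibLetter_block (k m o : ℕ) (ho : blockStart k m + o < blockStart k (m + 1)) :
    fibLetter (blockStart k m + o) = fibLetter o :=
  fibLetter_blockStart_add k m m o (lt_fib_add_two m) ho

lemma exists_blockStart_add (k t : ℕ) :
    ∃ m o, t = blockStart k m + o ∧ blockStart k m + o < blockStart k (m + 1) := by
  induction t with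
  | zero =>
    refine ⟨0, 0, rfl, ?_⟩
    rw [blockStart_succ, blockStart_zero, fibLetter_zero]
    simp
  | succ t ih =>
    obtain ⟨m, o, rfl, h⟩ := ih
    rcases lt_or_ge (blockStart k m + o + 1) (blockStart k (m + 1)) with h' | h'
    · exact ⟨m, o + 1, rfl, h'⟩
    · refine ⟨m + 1, 0, by omega, ?_⟩
      rw [blockStart_succ k (m + 1), add_zero]
      have h2 : 0 < Nat.fib (k + 2) := Nat.fib_pos.2 (by omega)
      have h3 : 0 < Nat.fib (k + 3) := Nat.fib_pos.2 (by omega)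
      split_ifs <;> omega

lemma blockStart_succ_of_zero (k : ℕ) {m : ℕ} (h : fibLetter m = 0) :
    blockStart k (m + 1) = blockStart k m + Nat.fib (k + 3) := by
  rw [blockStart_succ, if_pos h]

lemma blockStart_succ_of_one (k : ℕ) {m : ℕ} (h : fibLetter m = 1) :
    blockStart k (m + 1) = blockStart k m + Nat.fib (k + 2) := by
  rw [blockStart_succ, if_neg (by rw [h]; decide)]

lemma fibLetter_eq_zero_or_one (i : ℕ) : fibLetter i = 0 ∨ fibLetter i = 1 := by
  generalize fibLetter i = a
  revert a
  decide

lemma blockStart_lt_succ (k m : ℕ) : blockStart k m < blockStart k (m + 1) := by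
  have h2 : 0 < Nat.fib (k + 2) := Nat.fib_pos.2 (by omega)
  have h3 : 0 < Nat.fib (k + 3) := Nat.fib_pos.2 (by omega)
  rw [blockStart_succ]
  split_ifs <;> omega

lemma fibLetter_blockStart (k m : ℕ) : fibLetter (blockStart k m) = 0 := by
  have := fibLetter_block k m 0 (blockStart_lt_succ k m)
  rwa [add_zero, fibLetter_zero] at this

lemma fibLetter_succ_of_one {t : ℕ} (h : fibLetter t = 1) : fibLetter (t + 1) = 0 := by
  obtain ⟨m, o, rfl, hlt⟩ := exists_blockStart_add 0 t
  rw [fibLetter_block 0 m o hlt] at h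
  have hle : blockStart 0 (m + 1) ≤ blockStart 0 m + 2 := by
    rw [blockStart_succ]
    simp only [zero_add, show Nat.fib 3 = 2 from rfl, show Nat.fib 2 = 1 from rfl]
    split_ifs <;> omega
  have ho : o ≠ 0 := by
    rintro rfl
    rw [fibLetter_zero] at h
    exact absurd h (by decide)
  rw [show blockStart 0 m + o + 1 = blockStart 0 (m + 1) by omega]
  exact fibLetter_blockStart 0 (m + 1)

/-- `X_k X_{k-1}` and `X_{k-1} X_k` differ exactly in their last two letters. -/
lemma fibLetter_add_fib_eq_iff : ∀ k o, o < Nat.fib (k + 3) →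
    (fibLetter (o + Nat.fib (k + 2)) = fibLetter o ↔ o + 2 < Nat.fib (k + 3))
  | 0, o, h => by
    have h3 : Nat.fib (0 + 3) = 2 := rfl
    rw [h3] at h ⊢
    interval_cases o <;> decide
  | k + 1, o, h => by
    have h4 : Nat.fib (k + 1 + 3) = Nat.fib (k + 2) + Nat.fib (k + 3) := Nat.fib_add_two
    change fibLetter (o + Nat.fib (k + 3)) = _ ↔ _
    have h3 : 2 ≤ Nat.fib (k + 3) := Nat.fib_mono (show 3 ≤ k + 3 by omega)
    rcases lt_or_ge o (Nat.fib (k + 2)) with ho | ho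
    · rw [add_comm, fibLetter_fib_add k o ho]
      simp only [true_iff]
      omega
    · obtain ⟨o', rfl⟩ := Nat.exists_eq_add_of_le ho
      rw [show Nat.fib (k + 2) + o' + Nat.fib (k + 3) = Nat.fib (k + 1 + 3) + o' by omega,
        fibLetter_fib_add (k + 1) o' (show o' < Nat.fib (k + 3) by omega), add_comm _ o', eq_comm,
        fibLetter_add_fib_eq_iff k o' (by omega)]
      omega

/-- Whatever block follows `X_{k+3}`, it begins with `X_{k+2}`. -/
lemma fibLetter_blockStart_add_of_zero (k : ℕ) {m o : ℕ} (hm : fibLetter m = 0)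
    (ho : o < Nat.fib (k + 4)) : fibLetter (blockStart k m + o) = fibLetter o := by
  have h4 : Nat.fib (k + 4) = Nat.fib (k + 2) + Nat.fib (k + 3) := Nat.fib_add_two
  have h3 : Nat.fib (k + 2) ≤ Nat.fib (k + 3) := Nat.fib_mono (by omega)
  rcases lt_or_ge o (Nat.fib (k + 3)) with h | h
  · exact fibLetter_block k m o (by rw [blockStart_succ_of_zero k hm]; omega)
  · obtain ⟨o, rfl⟩ := Nat.exists_eq_add_of_le h
    rw [← add_assoc, ← blockStart_succ_of_zero k hm, fibLetter_fib_add k o (by omega)]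
    refine fibLetter_block k (m + 1) o ?_
    rw [blockStart_succ k (m + 1)]
    split_ifs <;> omega

/-- A 1 is followed by a 0, so the text reads `X_{k+2} X_{k+3}`, which departs from the prefix
`X_{k+3} X_{k+2}` only in its last two letters. -/
lemma fibLetter_blockStart_add_of_one (k : ℕ) {m o : ℕ} (hm : fibLetter m = 1)
    (ho : o + 2 < Nat.fib (k + 4)) : fibLetter (blockStart k m + o) = fibLetter o := by
  have h4 : Nat.fib (k + 4) = Nat.fib (k + 2) + Nat.fib (k + 3) := Nat.fib_add_two
  rcases lt_or_ge o (Nat.fib (k + 2)) with h | h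
  · exact fibLetter_block k m o (by rw [blockStart_succ_of_one k hm]; omega)
  · obtain ⟨o, rfl⟩ := Nat.exists_eq_add_of_le h
    rw [← add_assoc, ← blockStart_succ_of_one k hm, add_comm (Nat.fib (k + 2)) o,
      (fibLetter_add_fib_eq_iff k o (by omega)).2 (by omega)]
    refine fibLetter_block k (m + 1) o ?_
    rw [blockStart_succ_of_zero k (fibLetter_succ_of_one hm)]
    omega

/-! ### Positions of the squares of Fibonacci order. -/

/-- The infinite Fibonacci word has a square of order `j` at position `i`. -/
def FibSquareAt (j i : ℕ) : Prop := ∀ t < j, fibLetter (i + t) = fibLetter (i + t + j)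

instance (j : ℕ) : DecidablePred (FibSquareAt j) := fun _ => by
  unfold FibSquareAt; infer_instance

lemma fibLetter_eq_shift_of_zero (k : ℕ) {m o : ℕ} (hm : fibLetter m = 0)
    (ho : o < Nat.fib (k + 3)) :
    fibLetter (blockStart k m + o) = fibLetter (blockStart k m + o + Nat.fib (k + 2)) ↔
      o + 2 < Nat.fib (k + 3) := by
  have h4 : Nat.fib (k + 4) = Nat.fib (k + 2) + Nat.fib (k + 3) := Nat.fib_add_two
  rw [add_assoc (blockStart k m), fibLetter_blockStart_add_of_zero k hm (by omega),
    fibLetter_blockStart_add_of_zero k hm (by omega), eq_comm, fibLetter_add_fib_eq_iff k o ho]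

lemma fibLetter_eq_shift_of_one (k : ℕ) {m o : ℕ} (hm : fibLetter m = 1)
    (ho : o < Nat.fib (k + 2)) :
    fibLetter (blockStart k m + o) = fibLetter (blockStart k m + o + Nat.fib (k + 2)) := by
  have h3 : Nat.fib (k + 2) ≤ Nat.fib (k + 3) := Nat.fib_mono (by omega)
  rw [add_right_comm, ← blockStart_succ_of_one k hm, fibLetter_block k m o
    (by rw [blockStart_succ_of_one k hm]; omega), fibLetter_block k (m + 1) o
    (by rw [blockStart_succ_of_zero k (fibLetter_succ_of_one hm)]; omega)]

lemma fibSquareAt_of_one (k : ℕ) {m o : ℕ} (hm : fibLetter m = 1) (ho : o < Nat.fib (k + 2)) :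
    FibSquareAt (Nat.fib (k + 2)) (blockStart k m + o) := by
  intro t ht
  have h4 : Nat.fib (k + 3) = Nat.fib (k + 1) + Nat.fib (k + 2) := Nat.fib_add_two
  have h1 : 0 < Nat.fib (k + 1) := Nat.fib_pos.2 (by omega)
  rcases lt_or_ge (o + t) (Nat.fib (k + 2)) with h | h
  · rw [add_assoc (blockStart k m)]
    exact fibLetter_eq_shift_of_one k hm h
  · obtain ⟨s, hs⟩ := Nat.exists_eq_add_of_le h
    rw [add_assoc (blockStart k m), hs, ← add_assoc, ← blockStart_succ_of_one k hm]
    exact (fibLetter_eq_shift_of_zero k (fibLetter_succ_of_one hm) (by omega)).2 (by omega)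

lemma fibSquareAt_iff_of_zero (k : ℕ) {m o : ℕ} (hm : fibLetter m = 0)
    (ho : o < Nat.fib (k + 3)) :
    FibSquareAt (Nat.fib (k + 2)) (blockStart k m + o) ↔ o + 1 < Nat.fib (k + 1) := by
  have h4 : Nat.fib (k + 3) = Nat.fib (k + 1) + Nat.fib (k + 2) := Nat.fib_add_two
  have h1 : 0 < Nat.fib (k + 1) := Nat.fib_pos.2 (by omega)
  have h2 : 0 < Nat.fib (k + 2) := Nat.fib_pos.2 (by omega)
  constructor
  · intro h
    by_contra! hlt
    -- The tested offset is the first mismatch, `F_{k+3} - 2`. If `o = F_{k+3} - 1`, the subtraction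
    -- truncates to 0 and `o` itself is a mismatch.
    have h' := h (Nat.fib (k + 3) - 2 - o) (by omega)
    rw [add_assoc (blockStart k m), fibLetter_eq_shift_of_zero k hm (by omega)] at h'
    omega
  · intro h t ht
    rw [add_assoc (blockStart k m), fibLetter_eq_shift_of_zero k hm (by omega)]
    omega

lemma count_lt (a b : ℕ) : Nat.count (fun o => o < a) b = min a b := by
  induction b with
  | zero => simp
  | succ b ih => rw [Nat.count_succ, ih]; split_ifs <;> omega

lemma count_congr_of_lt {p q : ℕ → Prop} [DecidablePred p] [DecidablePred q] {n : ℕ}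
    (h : ∀ i < n, p i ↔ q i) : Nat.count p n = Nat.count q n := by
  rw [Nat.count_eq_card_filter_range, Nat.count_eq_card_filter_range]
  exact congrArg _ (Finset.filter_congr fun i hi => h i (Finset.mem_range.1 hi))

lemma count_fibSquareAt_of_zero (k : ℕ) {m b : ℕ} (hm : fibLetter m = 0)
    (hb : b ≤ Nat.fib (k + 3)) :
    Nat.count (fun o => FibSquareAt (Nat.fib (k + 2)) (blockStart k m + o)) b =
      min (Nat.fib (k + 1) - 1) b := by
  rw [← count_lt]
  refine count_congr_of_lt fun o ho => ?_
  rw [fibSquareAt_iff_of_zero k hm (by omega)]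
  omega

lemma count_fibSquareAt_of_one (k : ℕ) {m b : ℕ} (hm : fibLetter m = 1)
    (hb : b ≤ Nat.fib (k + 2)) :
    Nat.count (fun o => FibSquareAt (Nat.fib (k + 2)) (blockStart k m + o)) b = b := by
  rw [count_congr_of_lt (q := fun o => o < b)
    fun o ho => iff_of_true (fibSquareAt_of_one k hm (by omega)) ho, count_lt, min_self]

lemma count_fibSquareAt_blockStart (k m : ℕ) :
    Nat.count (FibSquareAt (Nat.fib (k + 2))) (blockStart k m) =
      Nat.count (fun l => fibLetter l = 0) m * (Nat.fib (k + 1) - 1) +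
      Nat.count (fun l => fibLetter l = 1) m * Nat.fib (k + 2) := by
  have h4 : Nat.fib (k + 3) = Nat.fib (k + 1) + Nat.fib (k + 2) := Nat.fib_add_two
  induction m with
  | zero => simp [blockStart_zero]
  | succ m ih =>
    rcases fibLetter_eq_zero_or_one m with h | h
    · rw [blockStart_succ_of_zero k h, Nat.count_add, ih, count_fibSquareAt_of_zero k h le_rfl,
        Nat.count_succ, Nat.count_succ, min_eq_left (by omega)]
      simp [h]; ring
    · rw [blockStart_succ_of_one k h, Nat.count_add, ih, count_fibSquareAt_of_one k h le_rfl,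
        Nat.count_succ, Nat.count_succ]
      simp [h]; ring

/-! ### Forbidden factors, by inspection of a finite prefix. -/

/-- Level 4 suffices: blocks have length 13 or 8, and from each block start the word agrees with its
prefix for at least 19 letters. -/
lemma exists_window_eq (p : ℕ) : ∃ o < 13, ∀ t < 8, fibLetter (p + t) = fibLetter (o + t) := by
  obtain ⟨m, o, rfl, h⟩ := exists_blockStart_add 4 p
  have h6 : Nat.fib (4 + 2) = 8 := rfl
  have h7 : Nat.fib (4 + 3) = 13 := rfl
  have h8 : Nat.fib (4 + 4) = 21 := rfl
  rcases fibLetter_eq_zero_or_one m with hm | hm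
  · rw [blockStart_succ_of_zero 4 hm] at h
    refine ⟨o, by omega, fun t ht => ?_⟩
    rw [add_assoc, fibLetter_blockStart_add_of_zero 4 hm (by omega)]
  · rw [blockStart_succ_of_one 4 hm] at h
    refine ⟨o, by omega, fun t ht => ?_⟩
    rw [add_assoc, fibLetter_blockStart_add_of_one 4 hm (by omega)]

lemma exists_window_getD (p : ℕ) :
    ∃ o < 13, ∀ t < 8, fibLetter (p + t) = (fibWord 8).getD (o + t) 0 := by
  obtain ⟨o, ho, h⟩ := exists_window_eq p
  refine ⟨o, ho, fun t ht => ?_⟩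
  rw [h t ht, List.getD_eq_getElem?_getD,
    fibWord_getElem? 6 (o + t) (by rw [show Nat.fib (6 + 2) = 21 from rfl]; omega)]
  rfl

lemma not_zero_zero_zero {p : ℕ} (h0 : fibLetter p = 0) (h1 : fibLetter (p + 1) = 0)
    (h2 : fibLetter (p + 2) = 0) : False := by
  obtain ⟨o, ho, h⟩ := exists_window_getD p
  have key : ∀ o < 13, ¬((fibWord 8).getD (o + 0) 0 = 0 ∧ (fibWord 8).getD (o + 1) 0 = 0 ∧
    (fibWord 8).getD (o + 2) 0 = 0) := by decide
  exact key o ho ⟨h 0 (by omega) ▸ h0, h 1 (by omega) ▸ h1, h 2 (by omega) ▸ h2⟩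

lemma not_one_zero_one_zero_one {p : ℕ} (h0 : fibLetter p = 1) (h2 : fibLetter (p + 2) = 1)
    (h4 : fibLetter (p + 4) = 1) : False := by
  obtain ⟨o, ho, h⟩ := exists_window_getD p
  have key : ∀ o < 13, ¬((fibWord 8).getD (o + 0) 0 = 1 ∧ (fibWord 8).getD (o + 2) 0 = 1 ∧
    (fibWord 8).getD (o + 4) 0 = 1) := by decide
  exact key o ho ⟨h 0 (by omega) ▸ h0, h 2 (by omega) ▸ h2, h 4 (by omega) ▸ h4⟩

lemma not_zero_zero_one_zero_zero_one_zero_zero {p : ℕ} (h0 : fibLetter p = 0)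
    (h1 : fibLetter (p + 1) = 0) (h3 : fibLetter (p + 3) = 0) (h4 : fibLetter (p + 4) = 0)
    (h6 : fibLetter (p + 6) = 0) (h7 : fibLetter (p + 7) = 0) : False := by
  obtain ⟨o, ho, h⟩ := exists_window_getD p
  have key : ∀ o < 13, ¬((fibWord 8).getD (o + 0) 0 = 0 ∧ (fibWord 8).getD (o + 1) 0 = 0 ∧
    (fibWord 8).getD (o + 3) 0 = 0 ∧ (fibWord 8).getD (o + 4) 0 = 0 ∧
    (fibWord 8).getD (o + 6) 0 = 0 ∧ (fibWord 8).getD (o + 7) 0 = 0) := by decide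
  exact key o ho ⟨h 0 (by omega) ▸ h0, h 1 (by omega) ▸ h1, h 3 (by omega) ▸ h3,
    h 4 (by omega) ▸ h4, h 6 (by omega) ▸ h6, h 7 (by omega) ▸ h7⟩

/-! ### Desubstitution and the possible orders of squares. -/

lemma blockStart_zero_succ_of_zero {m : ℕ} (h : fibLetter m = 0) :
    blockStart 0 (m + 1) = blockStart 0 m + 2 := blockStart_succ_of_zero 0 h

lemma blockStart_zero_succ_of_one {m : ℕ} (h : fibLetter m = 1) :
    blockStart 0 (m + 1) = blockStart 0 m + 1 := blockStart_succ_of_one 0 h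

lemma fibLetter_blockStart_zero_add_one (m : ℕ) :
    fibLetter (blockStart 0 m + 1) = 1 ↔ fibLetter m = 0 := by
  rcases fibLetter_eq_zero_or_one m with h | h
  · rw [fibLetter_block 0 m 1 (by rw [blockStart_zero_succ_of_zero h]; omega)]
    simp [h, fibLetter_one]
  · rw [← blockStart_zero_succ_of_one h, fibLetter_blockStart]
    simp [h]

lemma exists_eq_blockStart_zero {i : ℕ} (h : fibLetter i = 0) : ∃ a, i = blockStart 0 a := by
  obtain ⟨a, o, rfl, hlt⟩ := exists_blockStart_add 0 i
  rcases fibLetter_eq_zero_or_one a with ha | ha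
  · have hlt' := hlt
    rw [blockStart_zero_succ_of_zero ha] at hlt'
    obtain rfl | rfl : o = 0 ∨ o = 1 := by omega
    · exact ⟨a, rfl⟩
    · rw [(fibLetter_blockStart_zero_add_one a).2 ha] at h
      exact absurd h (by decide)
  · rw [blockStart_zero_succ_of_one ha] at hlt
    exact ⟨a, by omega⟩

lemma fibLetter_eq_of_iff {a b : ℕ} (h : fibLetter a = 0 ↔ fibLetter b = 0) :
    fibLetter a = fibLetter b := by
  rcases fibLetter_eq_zero_or_one a with ha | ha <;>
    rcases fibLetter_eq_zero_or_one b with hb | hb <;> simp_all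

lemma blockStart_zero_add (a s : ℕ) : blockStart 0 (a + s) =
    blockStart 0 a + (s + Nat.count (fun t => fibLetter (a + t) = 0) s) := by
  induction s with
  | zero => simp
  | succ s ih =>
    rw [Nat.count_succ, ← add_assoc a]
    rcases fibLetter_eq_zero_or_one (a + s) with h | h
    · rw [blockStart_zero_succ_of_zero h, ih, if_pos h]; ring
    · rw [blockStart_zero_succ_of_one h, ih, if_neg (by simp [h])]; ring

/-- Each of the images 01 and 0 contains exactly one 0. -/
lemma count_zero_blockStart_zero (a s : ℕ) :
    Nat.count (fun t => fibLetter (blockStart 0 a + t) = 0)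
      (s + Nat.count (fun t => fibLetter (a + t) = 0) s) = s := by
  induction s with
  | zero => simp
  | succ s ih =>
    have hs := blockStart_zero_add a s
    set N := s + Nat.count (fun t => fibLetter (a + t) = 0) s
    rw [Nat.count_succ]
    rcases fibLetter_eq_zero_or_one (a + s) with h | h
    · rw [if_pos h, show s + 1 + (Nat.count (fun t => fibLetter (a + t) = 0) s + 1) = N + 1 + 1 by
        omega, Nat.count_succ, Nat.count_succ, ih, ← hs, ← add_assoc, ← hs, fibLetter_blockStart,
        (fibLetter_blockStart_zero_add_one _).2 h]
      simp
    · rw [if_neg (by simp [h]), show s + 1 + (Nat.count (fun t => fibLetter (a + t) = 0) s + 0) =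
        N + 1 by omega, Nat.count_succ, ih, ← hs, fibLetter_blockStart]
      simp

/-- Block starts at level 0 are exactly the occurrences of 0, so both copies are cut into whole
blocks. Comparing them block by block transfers the square to the preimage. -/
lemma FibSquareAt.exists_desubstitution {i j : ℕ} (hj : 2 ≤ j) (h : FibSquareAt j i)
    (h0 : fibLetter i = 0) (h2 : fibLetter (i + j + j) = 0) :
    ∃ a j', 1 ≤ j' ∧ j' < j ∧ FibSquareAt j' a ∧
      j = j' + Nat.count (fun t => fibLetter (a + t) = 0) j' ∧
      Nat.count (fun t => fibLetter (i + t) = 0) j = j' := by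
  have h1 : fibLetter (i + j) = 0 := by
    have := h 0 (by omega)
    rwa [add_zero, h0, eq_comm] at this
  obtain ⟨a, rfl⟩ := exists_eq_blockStart_zero h0
  obtain ⟨b, hb⟩ := exists_eq_blockStart_zero h1
  have hab : a < b := by
    by_contra! hle
    have := blockStart_mono 0 hle
    omega
  obtain ⟨j', rfl⟩ := Nat.exists_eq_add_of_le hab.le
  have hjj : j = j' + Nat.count (fun t => fibLetter (a + t) = 0) j' := by
    rw [blockStart_zero_add] at hb
    omega
  have key : ∀ s, blockStart 0 (a + s) ≤ blockStart 0 a + j →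
      blockStart 0 (a + s) + j = blockStart 0 (a + j' + s) ∧
      ∀ t < s, fibLetter (a + t) = fibLetter (a + t + j') := by
    intro s
    induction s with
    | zero => intro _; exact ⟨hb, by simp⟩
    | succ s ih =>
      intro hs
      have hlt := blockStart_lt_succ 0 (a + s)
      rw [← add_assoc] at hs
      obtain ⟨e1, e2⟩ := ih (by omega)
      obtain ⟨u, hu⟩ := Nat.exists_eq_add_of_le (blockStart_mono 0 (Nat.le_add_right a s))
      have hstep : fibLetter (a + s) = fibLetter (a + j' + s) := by
        apply fibLetter_eq_of_iff
        rw [← fibLetter_blockStart_zero_add_one, ← fibLetter_blockStart_zero_add_one, ← e1, hu]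
        -- The letter after a 0 tells 01 from 0. For the last block it may lie just past the copy,
        -- where the 0 after the square is needed.
        rcases eq_or_ne (u + 1) j with hj' | hj'
        · rw [show blockStart 0 a + u + 1 = blockStart 0 a + j by omega,
            show blockStart 0 a + u + j + 1 = blockStart 0 a + j + j by omega, h1, h2]
        · rw [add_assoc, h (u + 1) (by omega),
            show blockStart 0 a + (u + 1) + j = blockStart 0 a + u + j + 1 by omega]
      constructor
      · rw [← add_assoc, ← add_assoc, blockStart_succ, blockStart_succ, ← hstep]
        omega
      · intro t ht
        rcases Nat.lt_succ_iff_lt_or_eq.1 ht with ht | rfl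
        · exact e2 t ht
        · rw [hstep, add_right_comm]
  refine ⟨a, j', by omega, ?_, (key j' hb.ge).2, hjj, ?_⟩
  · by_contra! hge
    have hc : Nat.count (fun t => fibLetter (a + t) = 0) j' = 0 := by omega
    have hone : ∀ t < j', fibLetter (a + t) = 1 := by
      intro t ht
      refine (fibLetter_eq_zero_or_one _).resolve_left fun h' => ?_
      have := Nat.count_strict_mono (p := fun t => fibLetter (a + t) = 0) h' ht
      omega
    have e0 := hone 0 (by omega)
    have e1 := fibLetter_succ_of_one e0
    rw [add_zero, hone 1 (by omega)] at e1
    exact absurd e1 (by decide)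
  · conv_lhs => rw [hjj]
    exact count_zero_blockStart_zero a j'

/-- For a square `xx` of any other order, the forbidden factors 000 and 1?1?1, applied to the middle
and to the neighbouring letters, force `x` to begin with 0100 and end with 0010. Then 00100100
straddles the middle, which is also forbidden. -/
lemma FibSquareAt.order_eq_one_or_three {i j : ℕ} (h : FibSquareAt j i)
    (h0 : fibLetter i = 0) (h2 : fibLetter (i + j + j) = 1)
    (hp : ∀ p, i = p + 1 → fibLetter p = 1) :
    j = 1 ∨ j = 3 ∧ fibLetter (i + 1) = 1 := by
  by_contra! hne
  have hz : ∀ {p}, fibLetter p = 0 → fibLetter p ≠ 1 := fun h h' => by simp [h] at h'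
  have hpred : ∀ p, fibLetter (p + 1) = 1 → fibLetter p = 0 := fun p hp =>
    (fibLetter_eq_zero_or_one p).resolve_right fun h' => hz (fibLetter_succ_of_one h') hp
  have hz1 : ∀ {p}, fibLetter p ≠ 0 → fibLetter p = 1 := fun h =>
    (fibLetter_eq_zero_or_one _).resolve_left h
  obtain ⟨r, rfl⟩ : ∃ r, j = r + 2 := by
    rcases j with _ | j
    · exact absurd h2 (hz h0)
    · exact ⟨j - 1, by omega⟩
  have hm : fibLetter (i + (r + 2)) = 0 := by rw [← h0]; exact (h 0 (by omega)).symm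
  have l1' : fibLetter (i + (r + 1) + (r + 2)) = 0 := hpred _ (by rw [← h2]; congr 1; ring)
  have l1 : fibLetter (i + (r + 1)) = 0 := (h (r + 1) (by omega)).trans l1'
  have l2 : fibLetter (i + r) = 1 := hz1 fun h' => not_zero_zero_zero h' l1 hm
  have m1 : fibLetter (i + (r + 2) + 1) = 1 := hz1 fun h' => not_zero_zero_zero l1 hm h'
  have a1 : fibLetter (i + 1) = 1 := by
    rw [h 1 (by omega), ← m1]; congr 1; ring
  have hr0 : r ≠ 0 := by rintro rfl; exact hz h0 l2
  have hr1 : r ≠ 1 := by rintro rfl; exact hne.2 rfl a1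
  have a2 : fibLetter (i + 2) = 0 := fibLetter_succ_of_one a1
  have hr2 : r ≠ 2 := by rintro rfl; exact hz a2 l2
  obtain ⟨q, rfl⟩ : ∃ q, r = q + 3 := ⟨r - 3, by omega⟩
  have l2' : fibLetter (i + (q + 3) + (q + 3 + 2)) = 1 := (h (q + 3) (by omega)).symm.trans l2
  have l4 : fibLetter (i + (q + 1)) = 0 := by
    by_contra h'
    have h'' := hz1 h'
    rw [h (q + 1) (by omega)] at h''
    refine not_one_zero_one_zero_one h'' ?_ ?_
    · rw [← l2']; congr 1; ring
    · rw [← h2]; congr 1; ring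
  have a3 : fibLetter (i + 3) = 0 := by
    by_contra h'
    have h'' := hz1 h'
    rcases i with _ | p
    · exact absurd h'' (by decide)
    · refine not_one_zero_one_zero_one (hp p rfl) ?_ ?_
      · rw [← a1]
      · rw [← h'']
  have l3 : fibLetter (i + (q + 2)) = 0 := hpred _ l2
  refine not_zero_zero_one_zero_zero_one_zero_zero l4 (p := i + (q + 1)) ?_ ?_ ?_ ?_ ?_
  · exact l3
  · exact l1
  · exact hm
  · rw [← a2, h 2 (by omega)]; congr 1; ring
  · rw [← a3, h 3 (by omega)]; congr 1; ring

lemma FibSquareAt.shift_left {i j : ℕ} (h : FibSquareAt j (i + 1))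
    (h0 : fibLetter i = 0) (h1 : fibLetter (i + j) = 0) :
    FibSquareAt j i ∧ Nat.count (fun t => fibLetter (i + t) = 0) j =
      Nat.count (fun t => fibLetter (i + 1 + t) = 0) j := by
  constructor
  · intro t ht
    rcases t with _ | t
    · rw [add_zero, h0, h1]
    · have := h t (by omega)
      rwa [show i + 1 + t = i + (t + 1) by ring] at this
  · have e1 := Nat.count_succ (fun t => fibLetter (i + t) = 0) j
    have e2 := Nat.count_succ' (fun t => fibLetter (i + t) = 0) j
    simp only [add_zero, h0, h1, if_true] at e1 e2
    simp only [show ∀ t, i + 1 + t = i + (t + 1) by intro t; ring]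
    omega

/-- The number of zeros is carried along because it governs lengths: the substitution sends (length,
zeros) `(F_{k+2}, F_{k+1})` to `(F_{k+3}, F_{k+2})`. -/
theorem FibSquareAt.exists_order_eq_fib : ∀ {j i : ℕ}, 1 ≤ j → FibSquareAt j i →
    ∃ k, j = Nat.fib (k + 2) ∧ Nat.count (fun t => fibLetter (i + t) = 0) j = Nat.fib (k + 1) := by
  intro j
  induction j using Nat.strong_induction_on with
  | _ j ih =>
  intro i hj h
  have closed : ∀ i, FibSquareAt j i → fibLetter i = 0 → fibLetter (i + j + j) = 0 →
      ∃ k, j = Nat.fib (k + 2) ∧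
        Nat.count (fun t => fibLetter (i + t) = 0) j = Nat.fib (k + 1) := by
    intro i h h0 h2
    rcases hj.eq_or_lt with rfl | hj2
    · exact ⟨0, rfl, by simp [Nat.count_succ, h0]⟩
    · obtain ⟨a, j', h1', hlt, hsq, e1, e2⟩ := h.exists_desubstitution hj2 h0 h2
      obtain ⟨k, f1, f2⟩ := ih j' hlt h1' hsq
      refine ⟨k + 1, ?_, e2.trans f1⟩
      rw [e1, f2, f1]
      exact (Nat.fib_add_two.trans (add_comm _ _)).symm
  have start : ∀ i, FibSquareAt j i → fibLetter i = 0 →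
      ∃ k, j = Nat.fib (k + 2) ∧
        Nat.count (fun t => fibLetter (i + t) = 0) j = Nat.fib (k + 1) := by
    intro i h h0
    rcases fibLetter_eq_zero_or_one (i + j + j) with h2 | h2
    · exact closed i h h0 h2
    by_cases hp : ∀ p, i = p + 1 → fibLetter p = 1
    · rcases h.order_eq_one_or_three h0 h2 hp with rfl | ⟨rfl, h1⟩
      · exact ⟨0, rfl, by simp [Nat.count_succ, h0]⟩
      · exact ⟨2, rfl, by simp [Nat.count_succ, h0, h1, fibLetter_succ_of_one h1, Nat.fib_add_two]⟩
    -- A square preceded by 0 and followed by 1 ends in 0; moved one step left it keeps its zero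
    -- count and is followed by 0.
    · push Not at hp
      obtain ⟨p, rfl, hp⟩ := hp
      have hp0 := (fibLetter_eq_zero_or_one p).resolve_right hp
      have hlast : fibLetter (p + j + j) = 0 := by
        refine (fibLetter_eq_zero_or_one _).resolve_right fun h' => ?_
        have := fibLetter_succ_of_one h'
        rw [show p + j + j + 1 = p + 1 + j + j by ring, h2] at this
        exact absurd this (by decide)
      have hmid : fibLetter (p + j) = 0 := by
        have := h (j - 1) (by omega)
        rwa [show p + 1 + (j - 1) = p + j by omega, hlast] at this
      obtain ⟨h', e⟩ := h.shift_left hp0 hmid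
      rw [← e]
      exact closed p h' hp0 hlast
  rcases fibLetter_eq_zero_or_one i with h0 | h0
  · exact start i h h0
  · rcases i with _ | p
    · exact absurd h0 (by decide)
    · have hpred : ∀ p, fibLetter (p + 1) = 1 → fibLetter p = 0 := fun p hp =>
        (fibLetter_eq_zero_or_one p).resolve_right fun h' => by
          rw [fibLetter_succ_of_one h'] at hp
          exact absurd hp (by decide)
      have hmid : fibLetter (p + j) = 0 := hpred _ (by
        rw [show p + j + 1 = p + 1 + 0 + j by ring, ← h 0 (by omega), add_zero, h0])
      obtain ⟨h', e⟩ := h.shift_left (hpred p h0) hmid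
      rw [← e]
      exact start p h' (hpred p h0)

/-! ### Counting the squares of each order in a finite word. -/

lemma isSquareWord_take_drop_iff {α : Type*} (w : List α) (i j : ℕ) (h : i + 2 * j ≤ w.length) :
    IsSquareWord ((w.drop i).take (2 * j)) ↔
      1 ≤ j ∧ ∀ t < j, w[i + t]? = w[i + t + j]? := by
  have hs : ∀ t < 2 * j, ((w.drop i).take (2 * j))[t]? = w[i + t]? := fun t ht => by
    rw [List.getElem?_take_of_lt ht, List.getElem?_drop]
  constructor
  · rintro ⟨x, hx, he⟩
    have hl : x.length = j := by
      have := congrArg List.length he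
      simp only [List.length_take, List.length_drop, List.length_append] at this
      omega
    refine ⟨hl ▸ List.length_pos_iff.2 hx, fun t ht => ?_⟩
    rw [← hs t (by omega), add_assoc, ← hs (t + j) (by omega), he,
      List.getElem?_append_left (by omega), List.getElem?_append_right (by omega),
      hl, Nat.add_sub_cancel]
  · rintro ⟨hj, he⟩
    have hl : ((w.drop i).take j).length = j := by
      simp only [List.length_take, List.length_drop]
      omega
    refine ⟨(w.drop i).take j, fun h0 => by rw [h0] at hl; simp at hl; omega, ?_⟩
    refine List.ext_getElem? fun t => ?_
    rcases lt_or_ge t j with ht | ht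
    · rw [hs t (by omega), List.getElem?_append_left (by omega), List.getElem?_take_of_lt ht,
        List.getElem?_drop]
    · rw [List.getElem?_append_right (by omega), hl]
      rcases lt_or_ge t (2 * j) with ht2 | ht2
      · rw [hs t ht2, List.getElem?_take_of_lt (by omega), List.getElem?_drop,
          he (t - j) (by omega)]
        congr 1
        omega
      · rw [List.getElem?_eq_none (by simp; omega), List.getElem?_eq_none (by simp; omega)]

lemma mem_squareOccurrences_fibWord (n i j : ℕ) :
    (i, j) ∈ squareOccurrences (fibWord (n + 2)) ↔
      1 ≤ j ∧ i + 2 * j ≤ Nat.fib (n + 2) ∧ FibSquareAt j i := by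
  have hl := length_fibWord (n + 2)
  simp only [squareOccurrences, Finset.mem_filter, Finset.mem_product, Finset.mem_range, hl]
  have key : i + 2 * j ≤ Nat.fib (n + 2) →
      (IsSquareWord (((fibWord (n + 2)).drop i).take (2 * j)) ↔ 1 ≤ j ∧ FibSquareAt j i) := by
    intro hle
    rw [isSquareWord_take_drop_iff _ i j (by omega)]
    refine and_congr_right fun _ => forall₂_congr fun t ht => ?_
    rw [fibWord_getElem? n _ (by omega), fibWord_getElem? n _ (by omega), Option.some.injEq]
  constructor
  · rintro ⟨-, hle, h⟩
    exact ⟨((key hle).1 h).1, hle, ((key hle).1 h).2⟩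
  · rintro ⟨hj, hle, h⟩
    exact ⟨by omega, hle, (key hle).2 ⟨hj, h⟩⟩

/-- Larger orders do not fit, as `2 F_{N+3} > F_{N+4}`. Indexing by `F_{l+2}` lists the order 1 only
once. -/
lemma numSquareOccurrences_eq_sum (N : ℕ) :
    numSquareOccurrences (N + 4) = ∑ l ∈ Finset.range (N + 1),
      Nat.count (FibSquareAt (Nat.fib (l + 2))) (Nat.fib (N + 4) + 1 - 2 * Nat.fib (l + 2)) := by
  rw [numSquareOccurrences, Finset.card_eq_sum_card_fiberwise (f := Prod.snd)
    (t := (Finset.range (N + 1)).image fun l => Nat.fib (l + 2)),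
    Finset.sum_image fun a _ b _ h => Nat.fib_add_two_strictMono.injective h]
  · refine Finset.sum_congr rfl fun l hl => ?_
    rw [Nat.count_eq_card_filter_range]
    have hpos : 0 < Nat.fib (l + 2) := Nat.fib_pos.2 (by omega)
    refine Finset.card_nbij' Prod.fst (fun i => (i, Nat.fib (l + 2))) ?_ ?_ ?_ ?_
    · rintro ⟨i, j⟩ h
      simp only [Finset.coe_filter, Set.mem_ofPred_eq, mem_squareOccurrences_fibWord (N + 2),
        Finset.mem_range] at h ⊢
      obtain ⟨⟨_, h1, h2⟩, rfl⟩ := h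
      exact ⟨by change i + _ ≤ Nat.fib (N + 4) at h1; omega, h2⟩
    · intro i h
      simp only [Finset.coe_filter, Set.mem_ofPred_eq, mem_squareOccurrences_fibWord (N + 2),
        Finset.mem_range] at h ⊢
      exact ⟨⟨hpos, by change i + _ ≤ Nat.fib (N + 4); omega, h.2⟩, trivial⟩
    · rintro ⟨i, j⟩ h
      simp only [Finset.coe_filter, Set.mem_ofPred_eq] at h
      simp [h.2]
    · intro i h
      rfl
  · rintro ⟨i, j⟩ h
    rw [Finset.mem_coe, mem_squareOccurrences_fibWord (N + 2)] at h
    obtain ⟨h1, h2, h3⟩ := h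
    change i + _ ≤ Nat.fib (N + 4) at h2
    obtain ⟨k, rfl, -⟩ := h3.exists_order_eq_fib h1
    simp only [Finset.coe_image, Finset.coe_range, Set.mem_image, Set.mem_Iio]
    refine ⟨k, ?_, rfl⟩
    by_contra! hk
    have e1 : Nat.fib (N + 4) = Nat.fib (N + 2) + Nat.fib (N + 3) := Nat.fib_add_two
    have e2 : Nat.fib (N + 3) = Nat.fib (N + 1) + Nat.fib (N + 2) := Nat.fib_add_two
    have e3 : Nat.fib (N + 3) ≤ Nat.fib (k + 2) := Nat.fib_mono (by omega)
    have e4 : 0 < Nat.fib (N + 1) := Nat.fib_pos.2 (by omega)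
    omega

lemma count_fibLetter_fib (a : Fin 2) (r : ℕ) :
    Nat.count (fun l => fibLetter l = a) (Nat.fib (r + 4)) =
      Nat.count (fun l => fibLetter l = a) (Nat.fib (r + 3)) +
      Nat.count (fun l => fibLetter l = a) (Nat.fib (r + 2)) := by
  rw [Nat.fib_add_two (n := r + 2), add_comm, Nat.count_add]
  congr 1
  exact count_congr_of_lt fun o ho => by rw [fibLetter_fib_add r o ho]

lemma count_zero_fib : ∀ r,
    Nat.count (fun l => fibLetter l = 0) (Nat.fib (r + 2)) = Nat.fib (r + 1)
  | 0 => by decide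
  | 1 => by decide
  | r + 2 => by
    rw [count_fibLetter_fib, count_zero_fib r, count_zero_fib (r + 1), add_comm]
    exact Nat.fib_add_two.symm

lemma count_one_fib : ∀ r, Nat.count (fun l => fibLetter l = 1) (Nat.fib (r + 2)) = Nat.fib r
  | 0 => by decide
  | 1 => by decide
  | r + 2 => by
    rw [count_fibLetter_fib, count_one_fib r, count_one_fib (r + 1), add_comm]
    exact Nat.fib_add_two.symm

lemma exists_last_two_letters : ∀ m, ∃ M, M + 2 = Nat.fib (m + 3) ∧
    (Even m ∧ fibLetter M = 0 ∧ fibLetter (M + 1) = 1 ∨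
      ¬Even m ∧ fibLetter M = 1 ∧ fibLetter (M + 1) = 0)
  | 0 => ⟨0, rfl, by decide⟩
  | 1 => ⟨1, rfl, by decide⟩
  | m + 2 => by
    obtain ⟨M, hM, h⟩ := exists_last_two_letters m
    refine ⟨Nat.fib (m + 1 + 3) + M, ?_, ?_⟩
    · rw [add_assoc, hM, Nat.fib_add_two (n := m + 3), add_comm]
    · rw [add_assoc (Nat.fib _), fibLetter_fib_add (m + 1) M (show M < Nat.fib (m + 3) by omega),
        fibLetter_fib_add (m + 1) (M + 1) (show M + 1 < Nat.fib (m + 3) by omega)]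
      simpa [Nat.even_add] using h

/-- The admissible starts fill all but the last two blocks and then `F_{l+1} + 1` further positions.
The parity of `m` decides whether these begin in a block of a 0, giving `F_{l+1} - 1` squares, or of
a 1, giving `F_{l+1} + 1`. -/
lemma count_fibSquareAt_fib (l m : ℕ) :
    (Nat.count (FibSquareAt (Nat.fib (l + 2)))
        (Nat.fib (m + l + 4) + 1 - 2 * Nat.fib (l + 2)) : ℤ) =
      Nat.fib (m + 1) * Nat.fib (l + 2) + Nat.fib (m + 2) * Nat.fib (l + 1) - Nat.fib (l + 2)
        - Nat.fib (m + 2) + 1 - (-1) ^ m - if l = 0 ∧ ¬Even m then 1 else 0 := by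
  obtain ⟨M, hM, h⟩ := exists_last_two_letters m
  have hb : blockStart l (M + 2) = Nat.fib (m + l + 4) := by
    rw [hM, blockStart_fib l (m + 1)]; congr 1; ring
  have e3 : Nat.fib (l + 3) = Nat.fib (l + 1) + Nat.fib (l + 2) := Nat.fib_add_two
  have p1 : 0 < Nat.fib (l + 1) := Nat.fib_pos.2 (by omega)
  have p2 : 0 < Nat.fib (l + 2) := Nat.fib_pos.2 (by omega)
  have hb2 : blockStart l (M + 2) = blockStart l M + Nat.fib (l + 3) + Nat.fib (l + 2) := by
    rcases h with ⟨-, h0, h1⟩ | ⟨-, h0, h1⟩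
    · rw [blockStart_succ_of_one l h1, blockStart_succ_of_zero l h0]
    · rw [blockStart_succ_of_zero l h1, blockStart_succ_of_one l h0, add_right_comm]
  have c0 : Nat.count (fun l => fibLetter l = 0) M + 1 = Nat.fib (m + 2) := by
    rw [← count_zero_fib (m + 1), ← hM, Nat.count_succ, Nat.count_succ]
    rcases h with ⟨-, h0, h1⟩ | ⟨-, h0, h1⟩ <;> simp [h0, h1]
  have c1 : Nat.count (fun l => fibLetter l = 1) M + 1 = Nat.fib (m + 1) := by
    rw [← count_one_fib (m + 1), ← hM, Nat.count_succ, Nat.count_succ]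
    rcases h with ⟨-, h0, h1⟩ | ⟨-, h0, h1⟩ <;> simp [h0, h1]
  rw [show Nat.fib (m + l + 4) + 1 - 2 * Nat.fib (l + 2) =
    blockStart l M + (Nat.fib (l + 1) + 1) by omega, Nat.count_add, count_fibSquareAt_blockStart,
    ← c0, ← c1]
  rcases h with ⟨hm, h0, h1⟩ | ⟨hm, h0, h1⟩
  · rw [count_fibSquareAt_of_zero l h0 (by omega), min_eq_left (by omega), hm.neg_one_pow,
      if_neg (by simp [hm])]
    push_cast [Nat.cast_sub p1]
    ring
  · rw [(Nat.not_even_iff_odd.1 hm).neg_one_pow]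
    rcases l with _ | l
    -- For order 1 the block of a 1 has length 1, so the second position spills into a block of a 0
    -- and starts no square. This is the source of the correction term.
    · have h2 : Nat.count (fun o => FibSquareAt (Nat.fib (0 + 2)) (blockStart 0 M + o))
          (Nat.fib (0 + 1) + 1) = 1 := by
        rw [Nat.count_add, count_fibSquareAt_of_one 0 h0 (by decide)]
        have := count_fibSquareAt_of_zero 0 (m := M + 1) (b := 1) h1 (by decide)
        rw [blockStart_succ_of_one 0 h0] at this
        simpa [add_assoc] using this
      rw [h2]
      simp [hm]
      ring
    · have p0 : 0 < Nat.fib (l + 1) := Nat.fib_pos.2 (by omega)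
      have e2 : Nat.fib (l + 1 + 2) = Nat.fib (l + 1) + Nat.fib (l + 1 + 1) := Nat.fib_add_two
      rw [count_fibSquareAt_of_one (l + 1) h0 (by omega), if_neg (by simp)]
      push_cast [Nat.cast_sub p1]
      ring

/-! ### Summation over the orders. -/

/-- The convolution satisfies the Fibonacci recurrence with the extra term `F_{N+2} + F_{N+3}`,
coming from the ends of the sum. -/
lemma five_mul_sum_fib_mul_fib : ∀ N : ℕ,
    5 * ∑ l ∈ Finset.range (N + 1), Nat.fib (l + 1) * Nat.fib (N - l + 2) =
      (2 * N + 1) * Nat.fib (N + 2) + (N + 2) * Nat.fib (N + 3)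
  | 0 => by decide
  | 1 => by decide
  | N + 2 => by
    have h : ∑ l ∈ Finset.range (N + 3), Nat.fib (l + 1) * Nat.fib (N + 2 - l + 2) =
        (∑ l ∈ Finset.range (N + 2), Nat.fib (l + 1) * Nat.fib (N + 1 - l + 2)) +
        (∑ l ∈ Finset.range (N + 1), Nat.fib (l + 1) * Nat.fib (N - l + 2)) +
        Nat.fib (N + 2) + Nat.fib (N + 3) := by
      rw [Finset.sum_range_succ, Finset.sum_range_succ, Finset.sum_range_succ _ (N + 1)]
      have : ∀ l ∈ Finset.range (N + 1), Nat.fib (l + 1) * Nat.fib (N + 2 - l + 2) =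
          Nat.fib (l + 1) * Nat.fib (N + 1 - l + 2) + Nat.fib (l + 1) * Nat.fib (N - l + 2) := by
        intro l hl
        have hl := Finset.mem_range.1 hl
        rw [show N + 2 - l + 2 = N - l + 2 + 2 by omega, Nat.fib_add_two,
          show N + 1 - l + 2 = N - l + 2 + 1 by omega]
        ring
      rw [Finset.sum_congr rfl this, Finset.sum_add_distrib,
        show N + 2 - (N + 1) + 2 = 3 by omega, show N + 1 - (N + 1) + 2 = 2 by omega,
        show N + 2 - (N + 2) + 2 = 2 by omega, show Nat.fib 3 = 2 from rfl,
        show Nat.fib 2 = 1 from rfl]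
      ring
    rw [h, mul_add, mul_add, mul_add, five_mul_sum_fib_mul_fib N, five_mul_sum_fib_mul_fib (N + 1)]
    have e5 : Nat.fib (N + 2 + 3) = Nat.fib (N + 3) + Nat.fib (N + 4) := Nat.fib_add_two
    have e4 : Nat.fib (N + 4) = Nat.fib (N + 2) + Nat.fib (N + 3) := Nat.fib_add_two
    rw [e5, show N + 2 + 2 = N + 4 by ring, show N + 1 + 3 = N + 4 by ring,
      show N + 1 + 2 = N + 3 by ring, e4]
    ring

lemma sum_fib_add_two (N : ℕ) :
    ∑ l ∈ Finset.range (N + 1), Nat.fib (l + 2) + 2 = Nat.fib (N + 4) := by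
  induction N with
  | zero => rfl
  | succ N ih =>
    rw [Finset.sum_range_succ, add_right_comm, ih, add_comm]
    exact Nat.fib_add_two.symm

/-- The alternating sum is 1 or 0 as `N` is even or odd, and the order-1 correction supplies the
missing 1 for odd `N`. -/
lemma sum_neg_one_pow_add_ite (N : ℕ) :
    ∑ l ∈ Finset.range (N + 1), ((-1 : ℤ) ^ (N - l) + if l = 0 ∧ ¬Even (N - l) then 1 else 0) =
      1 := by
  rw [Finset.sum_add_distrib, Finset.sum_flip (fun l => (-1 : ℤ) ^ l), neg_one_geom_sum,
    Finset.sum_range_succ']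
  by_cases h : Even N <;> simp [h, Nat.even_add_one]

lemma numSquareOccurrences_add_four (N : ℕ) : (numSquareOccurrences (N + 4) : ℤ) =
    2 * ((∑ l ∈ Finset.range (N + 1), Nat.fib (l + 1) * Nat.fib (N - l + 2) : ℕ) : ℤ)
      - 2 * Nat.fib (N + 4) + 4 + N := by
  have hA : ∑ l ∈ Finset.range (N + 1), Nat.fib (N - l + 1) * Nat.fib (l + 2) =
      ∑ l ∈ Finset.range (N + 1), Nat.fib (l + 1) * Nat.fib (N - l + 2) := by
    rw [← Finset.sum_flip]
    refine Finset.sum_congr rfl fun l hl => ?_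
    rw [Nat.sub_sub_self (Nat.lt_succ_iff.1 (Finset.mem_range.1 hl))]
  have hF := sum_fib_add_two N
  have hF' := hF
  rw [← Finset.sum_flip] at hF'
  have hS := sum_neg_one_pow_add_ite N
  have hterm : ∀ l ∈ Finset.range (N + 1), (Nat.count (FibSquareAt (Nat.fib (l + 2)))
      (Nat.fib (N + 4) + 1 - 2 * Nat.fib (l + 2)) : ℤ) =
      ((Nat.fib (N - l + 1) * Nat.fib (l + 2) : ℕ) : ℤ)
        + ((Nat.fib (l + 1) * Nat.fib (N - l + 2) : ℕ) : ℤ)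
        - (Nat.fib (l + 2) : ℤ) - (Nat.fib (N - l + 2) : ℤ) + 1
        - ((-1) ^ (N - l) + if l = 0 ∧ ¬Even (N - l) then 1 else 0) := by
    intro l hl
    have hl := Finset.mem_range.1 hl
    have := count_fibSquareAt_fib l (N - l)
    rw [show N - l + l + 4 = N + 4 by omega] at this
    rw [this]
    push_cast
    ring
  rw [numSquareOccurrences_eq_sum, Nat.cast_sum, Finset.sum_congr rfl hterm]
  simp only [Finset.sum_sub_distrib, Finset.sum_add_distrib (g := fun _ => (1 : ℤ)),
    Finset.sum_add_distrib (f := fun l => ((Nat.fib (N - l + 1) * Nat.fib (l + 2) : ℕ) : ℤ))]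
  rw [hS, ← Nat.cast_sum, ← Nat.cast_sum, ← Nat.cast_sum, ← Nat.cast_sum, hA]
  zify at hF hF'
  simp only [Finset.sum_const, Finset.card_range, nsmul_eq_mul, mul_one]
  push_cast at hF hF' ⊢
  linarith

theorem mainTheorem9 (n : ℕ) (hn : 3 ≤ n) :
    (numSquareOccurrences (n + 1) : ℚ) =
      4 / 5 * (n : ℚ) * (Nat.fib (n + 1) : ℚ) - 2 / 5 * ((n : ℚ) + 6) * (Nat.fib n : ℚ)
        - 4 * (Nat.fib (n - 1) : ℚ) + (n : ℚ) + 1 := by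
  obtain ⟨N, rfl⟩ := Nat.exists_eq_add_of_le' hn
  have h1 := congrArg (Int.cast : ℤ → ℚ) (numSquareOccurrences_add_four N)
  have h2 := five_mul_sum_fib_mul_fib N
  have h3 : Nat.fib (N + 4) = Nat.fib (N + 2) + Nat.fib (N + 3) := Nat.fib_add_two
  rw [show N + 3 - 1 = N + 2 by omega, show N + 3 + 1 = N + 4 by ring]
  apply_fun (Nat.cast : ℕ → ℚ) at h2 h3
  push_cast at h1 h2 h3 ⊢
  rw [h1, h3]
  linarith
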